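/- Let $\ell$ be the horizontal axis of the plane. Let $\mathcal C$ be a finite set of upper semicircles with pairwise different centres on $\ell$ (each semicircle contains its two endpoints on $\ell$), such that at most two of them pass through any given point. Let $G_{\mathcal C}$ be the planar graph whose vertices are the points where two semicircles meet or a semicircle meets $\ell$, and whose edges are the arcs between vertices. For small $\varepsilon>0$ let $G^r_{\mathcal C}=G^r_{\mathcal C}(\varepsilon)$ be the resolution of $G_{\mathcal C}$, obtained as follows. - At each crossing $p$ of two semicircles above $\ell$, the 4-valent vertex $p$ is replaced, inside a small neighbourhood, by two trivalent vertices $p+(0,\varepsilon)$ and $p-(0,\varepsilon)$ joined by a vertical edge; the upper one is joined to the two upper arcs at $p$, the lower one to the two lower arcs. (Over $|a-p_1|\le\varepsilon$, the upper envelope of the two semicircles is raised, and the lower envelope lowered, by $\varepsilon-|a-p_1|$.) - At each point $p\in\ell$ that is the right endpoint of one semicircle and the left endpoint of another, the V formed by them is replaced by a Y: a vertical edge from $p$ to the trivalent vertex $p+(0,\varepsilon)$, from which the two semicircles continue. (Over $|a-p_1|\le\varepsilon$, the V is raised by $\varepsilon-|a-p_1|$.) - Everything else is unchanged, including an endpoint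 shared by two semicircles one of which lies inside the other. The changed neighbourhood is the region between the two new branches at each crossing and the region above $\ell$ and on or below the new branch at each V; its boundary is included. For a point $x$ above $\ell$ and on no edge or vertex, the circle depth $d^c(x,\mathcal C)$ is the number of semicircles in $\mathcal C$ above $x$. The path depth $d^p(x,G)$ is the minimal number of edge crossings of a continuous path from $x$ to the unbounded face of $G$ above $\ell$ that stays strictly above $\ell$ and avoids the vertices of $G$ (the distance in the dual graph). Then for all sufficiently small $\varepsilon>0$ (depending only on $\mathcal C$), every point $x$ above $\ell$ that lies on a face of both $G_{\mathcal C}$ and $G^r_{\mathcal C}(\varepsilon)$ and outside the changed neighbourhoods satisfies $$d^c(x,\mathcal C)=d^p(x,G^r_{\mathcal C}(\varepsilon)).$$ -/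

import Mathlib

open Filter Topology

/-- An upper semicircle centred on the line `ℓ = {y = 0}`. -/
@[ext] structure UpperSemicircle where
  center : ℝ
  radius : ℝ
  radius_pos : 0 < radius

namespace UpperSemicircle

/-- The points of the semicircle, both endpoints on `ℓ` included. -/
def arc (s : UpperSemicircle) : Set (ℝ × ℝ) :=
  {q | (q.1 - s.center) ^ 2 + q.2 ^ 2 = s.radius ^ 2 ∧ 0 ≤ q.2}

def leftEnd (s : UpperSemicircle) : ℝ × ℝ := (s.center - s.radius, 0)

def rightEnd (s : UpperSemicircle) : ℝ × ℝ := (s.center + s.radius, 0)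

/-- The height of the semicircle over the abscissa `a`
(`0` when no point of the semicircle has abscissa `a`). -/
noncomputable def height (s : UpperSemicircle) (a : ℝ) : ℝ :=
  Real.sqrt (s.radius ^ 2 - (a - s.center) ^ 2)

/-- The semicircle `s` passes above the point `x`. -/
def IsAbove (s : UpperSemicircle) (x : ℝ × ℝ) : Prop :=
  ∃ h : ℝ, x.2 < h ∧ (x.1, h) ∈ s.arc

/-- `s` and `t` cross at the point `p` above `ℓ`. -/
def CrossAt (s t : UpperSemicircle) (p : ℝ × ℝ) : Prop :=
  s ≠ t ∧ p ∈ s.arc ∧ p ∈ t.arc ∧ 0 < p.2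

/-- `s` ends on the right at the boundary point `p`, where `t` starts on the left,
so that the two semicircles form a V at `p`. -/
def VeeAt (s t : UpperSemicircle) (p : ℝ × ℝ) : Prop :=
  p = s.rightEnd ∧ p = t.leftEnd

end UpperSemicircle

/-- A sequence of upper semicircles: a finite set of upper semicircles
with pairwise different centres. -/
structure SemicircleSeq where
  arcs : Finset UpperSemicircle
  center_injOn : Set.InjOn UpperSemicircle.center (arcs : Set UpperSemicircle)

/-- A planar graph drawn in the closed half-plane above `ℓ`, given by its set of vertices
and by the union of all its vertices and edges. -/
structure HalfPlaneGraph where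
  vertices : Set (ℝ × ℝ)
  carrier : Set (ℝ × ℝ)

namespace HalfPlaneGraph

/-- The (open) edges: the pieces into which the vertices cut the drawing. -/
def edges (G : HalfPlaneGraph) : Set (Set (ℝ × ℝ)) :=
  {e | ∃ q ∈ G.carrier \ G.vertices, e = connectedComponentIn (G.carrier \ G.vertices) q}

/-- The part of the open upper half-plane that is not covered by the drawing. -/
def faceRegion (G : HalfPlaneGraph) : Set (ℝ × ℝ) :=
  {q | 0 < q.2 ∧ q ∉ G.carrier ∪ G.vertices}

/-- The faces above `ℓ`. -/
def faces (G : HalfPlaneGraph) : Set (Set (ℝ × ℝ)) :=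
  {F | ∃ q ∈ G.faceRegion, F = connectedComponentIn G.faceRegion q}

/-- `γ` does not meet the boundary line and avoids all vertices. -/
def IsAdmissible (G : HalfPlaneGraph) {x z : ℝ × ℝ} (γ : Path x z) : Prop :=
  ∀ t, 0 < (γ t).2 ∧ γ t ∉ G.vertices

/-- The number of times that `γ` meets an edge. -/
noncomputable def crossingNumber (G : HalfPlaneGraph) {x z : ℝ × ℝ} (γ : Path x z) : ℕ∞ :=
  {t | ∃ e ∈ G.edges, γ t ∈ e}.encard

/-- The path depth of `x`: the least number of edge crossings of a path from `x` to the
unbounded face that stays above the boundary line and avoids the vertices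
(`⊤` if there is no such path). -/
noncomputable def pathDepth (G : HalfPlaneGraph) (x : ℝ × ℝ) : ℕ∞ :=
  sInf {n | ∃ F ∈ G.faces, ¬ Bornology.IsBounded F ∧
    ∃ z ∈ F, ∃ γ : Path x z, G.IsAdmissible γ ∧ G.crossingNumber γ = n}

end HalfPlaneGraph

namespace SemicircleSeq

open UpperSemicircle

/-- The number of semicircles above `x`. -/
noncomputable def circleDepth (C : SemicircleSeq) (x : ℝ × ℝ) : ℕ :=
  {s | s ∈ C.arcs ∧ s.IsAbove x}.ncard

/-- The planar graph determined by `C`: its vertices are the points where two semicircles meet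
and the points where a semicircle meets `ℓ`. -/
def graph (C : SemicircleSeq) : HalfPlaneGraph where
  vertices := {q | (∃ s ∈ C.arcs, ∃ t ∈ C.arcs, s ≠ t ∧ q ∈ s.arc ∧ q ∈ t.arc) ∨
    ∃ s ∈ C.arcs, q ∈ s.arc ∧ q.2 = 0}
  carrier := {q | ∃ s ∈ C.arcs, q ∈ s.arc}

/-- The points at which the graph of `C` has to be resolved: the crossings above `ℓ`
and the boundary points with a V. -/
def resolvedPoints (C : SemicircleSeq) : Set (ℝ × ℝ) :=
  {p | ∃ s ∈ C.arcs, ∃ t ∈ C.arcs, s.CrossAt t p ∨ s.VeeAt t p}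

/-- The upper envelope of `s` and `t` over `[p.1 - ε, p.1 + ε]`, lifted by `ε` over `p.1`. -/
def upperBranch (ε : ℝ) (s t : UpperSemicircle) (p : ℝ × ℝ) : Set (ℝ × ℝ) :=
  {q | |q.1 - p.1| ≤ ε ∧ q.2 = max (s.height q.1) (t.height q.1) + (ε - |q.1 - p.1|)}

/-- The lower envelope of `s` and `t` over `[p.1 - ε, p.1 + ε]`, lowered by `ε` over `p.1`. -/
def lowerBranch (ε : ℝ) (s t : UpperSemicircle) (p : ℝ × ℝ) : Set (ℝ × ℝ) :=
  {q | |q.1 - p.1| ≤ ε ∧ q.2 = min (s.height q.1) (t.height q.1) - (ε - |q.1 - p.1|)}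

/-- The vertical segment over the abscissa `a` between the heights `h` and `k`. -/
def verticalEdge (a h k : ℝ) : Set (ℝ × ℝ) :=
  {q | q.1 = a ∧ h ≤ q.2 ∧ q.2 ≤ k}

/-- The resolution of the graph of `C` at scale `ε`.  Near a crossing `p` of `s` and `t`, the
4-valent vertex `p` is replaced by the trivalent vertices `p + (0, ε)` and `p - (0, ε)`, joined
by a vertical edge; the first takes the two upper edges at `p`, the second the two lower ones.
Near a boundary point with a V, the V is replaced by a Y with the trivalent vertex `p + (0, ε)`.
Everything else is left as it is. -/
def resolvedGraph (C : SemicircleSeq) (ε : ℝ) : HalfPlaneGraph where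
  vertices := {q | (∃ s ∈ C.arcs, q = s.leftEnd ∨ q = s.rightEnd) ∨
    (∃ s ∈ C.arcs, ∃ t ∈ C.arcs, ∃ p, s.CrossAt t p ∧
      (q = (p.1, p.2 + ε) ∨ q = (p.1, p.2 - ε))) ∨
    ∃ s ∈ C.arcs, ∃ t ∈ C.arcs, ∃ p, s.VeeAt t p ∧ q = (p.1, p.2 + ε)}
  carrier := {q | (∃ s ∈ C.arcs, q ∈ s.arc ∧
      ∀ p ∈ C.resolvedPoints, p ∈ s.arc → ε ≤ |q.1 - p.1|) ∨
    (∃ s ∈ C.arcs, ∃ t ∈ C.arcs, ∃ p, s.CrossAt t p ∧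
      (q ∈ upperBranch ε s t p ∨ q ∈ lowerBranch ε s t p ∨
        q ∈ verticalEdge p.1 (p.2 - ε) (p.2 + ε))) ∨
    ∃ s ∈ C.arcs, ∃ t ∈ C.arcs, ∃ p, s.VeeAt t p ∧
      (q ∈ upperBranch ε s t p ∨ q ∈ verticalEdge p.1 p.2 (p.2 + ε))}

/-- The small neighbourhoods in which the resolution at scale `ε` changes the drawing: the points
between the two new branches at a crossing, or below the new branch at a V. -/
def changedRegion (C : SemicircleSeq) (ε : ℝ) : Set (ℝ × ℝ) :=
  {q | (∃ s ∈ C.arcs, ∃ t ∈ C.arcs, ∃ p, s.CrossAt t p ∧ |q.1 - p.1| ≤ ε ∧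
      min (s.height q.1) (t.height q.1) - (ε - |q.1 - p.1|) ≤ q.2 ∧
      q.2 ≤ max (s.height q.1) (t.height q.1) + (ε - |q.1 - p.1|)) ∨
    ∃ s ∈ C.arcs, ∃ t ∈ C.arcs, ∃ p, s.VeeAt t p ∧ |q.1 - p.1| ≤ ε ∧
      0 ≤ q.2 ∧ q.2 ≤ max (s.height q.1) (t.height q.1) + (ε - |q.1 - p.1|)}

end SemicircleSeq

/-! The lower bound on the path depth comes from the integer `resolvedDepth`, which counts the
curves of the resolved drawing above a point: near a crossing or a V the two semicircles are
replaced by the graphs of `upperHeight` and `lowerHeight`. For small `ε` at most one counted graph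
passes through any given point above the line. Hence the count takes at most two consecutive values
locally and is locally constant off the drawing (`IsSmall.exists_local_sum`). It equals the circle
depth outside the changed neighbourhoods and vanishes on unbounded faces, so along an admissible
path it falls from the circle depth to `0` in unit steps, each made on an edge
(`le_encard_of_locally_two_valued`). Vertical edges carry no jump and can only add crossings.

For the upper bound, `x` is shifted horizontally within its face to an abscissa without resolved
points and then moved straight up. This path meets no vertex and no vertical edge. Each crossing
lies on the piece that replaces some semicircle above `x`, and no semicircle is used twice
(`exists_isLevel`, `IsSmall.isLevel_unique`). -/

namespace UpperSemicircle

/-! ### Heights, resolved points and changed neighbourhoods -/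

theorem continuous_height (s : UpperSemicircle) : Continuous s.height := by
  unfold height; fun_prop

theorem height_nonneg (s : UpperSemicircle) (a : ℝ) : 0 ≤ s.height a := Real.sqrt_nonneg _

theorem height_le_radius (s : UpperSemicircle) (a : ℝ) : s.height a ≤ s.radius :=
  Real.sqrt_le_iff.2 ⟨s.radius_pos.le, by nlinarith [sq_nonneg (a - s.center)]⟩

theorem height_eq_of_mem_arc {s : UpperSemicircle} {q : ℝ × ℝ} (hq : q ∈ s.arc) :
    s.height q.1 = q.2 := by
  obtain ⟨h, h0⟩ := hq
  rw [height, show s.radius ^ 2 - (q.1 - s.center) ^ 2 = q.2 ^ 2 by linarith, Real.sqrt_sq h0]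

theorem mem_arc_of_height_eq {s : UpperSemicircle} {q : ℝ × ℝ} (h0 : 0 < q.2)
    (h : s.height q.1 = q.2) : q ∈ s.arc := by
  have hpos : 0 < s.radius ^ 2 - (q.1 - s.center) ^ 2 := 
    Real.sqrt_pos.1 (show 0 < s.height q.1 from h ▸ h0)
  have := Real.sq_sqrt hpos.le
  rw [← height, h] at this
  exact ⟨by linarith, h0.le⟩

theorem isAbove_iff {s : UpperSemicircle} {x : ℝ × ℝ} (h0 : 0 < x.2) :
    s.IsAbove x ↔ x.2 < s.height x.1 := by
  constructor
  · rintro ⟨h, hlt, hmem⟩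
    have := height_eq_of_mem_arc hmem
    simp only at this
    rwa [this]
  · intro h
    exact ⟨_, h, mem_arc_of_height_eq (h0.trans h) rfl⟩

theorem isClosed_arc (s : UpperSemicircle) : IsClosed s.arc := by
  have h1 : IsClosed {q : ℝ × ℝ | (q.1 - s.center) ^ 2 + q.2 ^ 2 = s.radius ^ 2} :=
    isClosed_eq (by fun_prop) (by fun_prop)
  have h2 : IsClosed {q : ℝ × ℝ | 0 ≤ q.2} := isClosed_le (by fun_prop) (by fun_prop)
  exact h1.inter h2

/-- Two semicircles with different centres have the same abscissa at all common points. -/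
theorem fst_eq_of_mem_arc {s t : UpperSemicircle} (hc : s.center ≠ t.center) {p q : ℝ × ℝ}
    (hps : p ∈ s.arc) (hpt : p ∈ t.arc) (hqs : q ∈ s.arc) (hqt : q ∈ t.arc) : p.1 = q.1 := by
  -- The difference of the two circle equations is linear in the abscissa: it is the equation of the
  -- radical axis.
  have h : (t.center - s.center) * (p.1 - q.1) = 0 := by
    linear_combination (hps.1 - hpt.1 - hqs.1 + hqt.1) / 2
  rcases mul_eq_zero.1 h with h | h
  · exact absurd (by linarith) hc
  · linarith

theorem eq_of_mem_arc {s t : UpperSemicircle} (hc : s.center ≠ t.center) {p q : ℝ × ℝ}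
    (hps : p ∈ s.arc) (hpt : p ∈ t.arc) (hqs : q ∈ s.arc) (hqt : q ∈ t.arc) : p = q := by
  have h := fst_eq_of_mem_arc hc hps hpt hqs hqt
  refine Prod.ext h ?_
  rw [← height_eq_of_mem_arc hps, ← height_eq_of_mem_arc hqs, h]

theorem rightEnd_mem_arc (s : UpperSemicircle) : s.rightEnd ∈ s.arc := by
  constructor <;> simp [rightEnd]

theorem leftEnd_mem_arc (s : UpperSemicircle) : s.leftEnd ∈ s.arc := by
  constructor <;> simp [leftEnd]

theorem VeeAt.center_lt {s t : UpperSemicircle} {p : ℝ × ℝ} (h : s.VeeAt t p) :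
    s.center < t.center := by
  have := congrArg Prod.fst (h.1.symm.trans h.2)
  simp only [rightEnd, leftEnd] at this
  linarith [s.radius_pos, t.radius_pos]

/-- The bases of the two semicircles share only an endpoint, so over every abscissa one of the
heights is `0`, possibly as the default value of the square root. -/
theorem VeeAt.min_height {s t : UpperSemicircle} {p : ℝ × ℝ} (h : s.VeeAt t p) (a : ℝ) :
    min (s.height a) (t.height a) = 0 := by
  have e := congrArg Prod.fst (h.1.symm.trans h.2)
  simp only [rightEnd, leftEnd] at e
  have hs := s.radius_pos
  have ht := t.radius_pos
  rcases le_total a (s.center + s.radius) with ha | ha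
  · rw [min_eq_right]
    · exact Real.sqrt_eq_zero_of_nonpos (by nlinarith)
    · rw [height, Real.sqrt_eq_zero_of_nonpos (by nlinarith)]; exact height_nonneg _ _
  · rw [min_eq_left]
    · exact Real.sqrt_eq_zero_of_nonpos (by nlinarith)
    · rw [height, Real.sqrt_eq_zero_of_nonpos (by nlinarith)]; exact height_nonneg _ _

/-- `s` and `t`, ordered by their centres, form at `p` a crossing or a V. -/
def ResolvedAt (s t : UpperSemicircle) (p : ℝ × ℝ) : Prop :=
  s.center < t.center ∧ (s.CrossAt t p ∨ s.VeeAt t p)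

theorem ResolvedAt.mem_left {s t : UpperSemicircle} {p : ℝ × ℝ} (h : s.ResolvedAt t p) :
    p ∈ s.arc := by
  rcases h.2 with h | h
  · exact h.2.1
  · exact h.1 ▸ s.rightEnd_mem_arc

theorem ResolvedAt.mem_right {s t : UpperSemicircle} {p : ℝ × ℝ} (h : s.ResolvedAt t p) :
    p ∈ t.arc := by
  rcases h.2 with h | h
  · exact h.2.2.1
  · exact h.2 ▸ t.leftEnd_mem_arc

theorem CrossAt.symm {s t : UpperSemicircle} {p : ℝ × ℝ} (h : s.CrossAt t p) : t.CrossAt s p :=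
  ⟨h.1.symm, h.2.2.1, h.2.1, h.2.2.2⟩

/-- The height by which the new branches over `a` are moved at a point with abscissa `b`. -/
def bump (ε b a : ℝ) : ℝ := max 0 (ε - |a - b|)

theorem bump_nonneg (ε b a : ℝ) : 0 ≤ bump ε b a := le_max_left _ _

theorem bump_of_le {ε b a : ℝ} (h : |a - b| ≤ ε) : bump ε b a = ε - |a - b| :=
  max_eq_right (by linarith)

theorem bump_of_lt {ε b a : ℝ} (h : ε < |a - b|) : bump ε b a = 0 :=
  max_eq_left (by linarith)

theorem continuous_bump (ε b : ℝ) : Continuous (bump ε b) := by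
  unfold bump; fun_prop

/-- The cut-off in `bump` makes both branches continuous on the whole line; beyond distance `ε` they
are the plain envelopes. At a V the lower branch is nowhere above the line, so crossings and Vs can
be treated alike. -/
noncomputable def upperHeight (ε b : ℝ) (s t : UpperSemicircle) (a : ℝ) : ℝ :=
  max (s.height a) (t.height a) + bump ε b a

noncomputable def lowerHeight (ε b : ℝ) (s t : UpperSemicircle) (a : ℝ) : ℝ :=
  min (s.height a) (t.height a) - bump ε b a

theorem continuous_upperHeight (ε b : ℝ) (s t : UpperSemicircle) :
    Continuous (upperHeight ε b s t) :=
  (s.continuous_height.max t.continuous_height).add (continuous_bump ε b)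

theorem continuous_lowerHeight (ε b : ℝ) (s t : UpperSemicircle) :
    Continuous (lowerHeight ε b s t) :=
  (s.continuous_height.min t.continuous_height).sub (continuous_bump ε b)

/-- The neighbourhood in which the resolution at `p` changes the drawing of `s` and `t`. -/
def changedAt (ε : ℝ) (s t : UpperSemicircle) (p : ℝ × ℝ) : Set (ℝ × ℝ) :=
  {q | |q.1 - p.1| ≤ ε ∧ lowerHeight ε p.1 s t q.1 ≤ q.2 ∧ q.2 ≤ upperHeight ε p.1 s t q.1}

theorem isClosed_changedAt (ε : ℝ) (s t : UpperSemicircle) (p : ℝ × ℝ) :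
    IsClosed (changedAt ε s t p) := by
  have h1 := continuous_lowerHeight ε p.1 s t
  have h2 := continuous_upperHeight ε p.1 s t
  have h3 : IsClosed {q : ℝ × ℝ | |q.1 - p.1| ≤ ε} := isClosed_le (by fun_prop) (by fun_prop)
  exact h3.inter ((isClosed_le (h1.comp continuous_fst) continuous_snd).inter
    (isClosed_le continuous_snd (h2.comp continuous_fst)))

theorem mem_changedAt_of_height_eq {ε : ℝ} {s t : UpperSemicircle} {p q : ℝ × ℝ}
    (h : |q.1 - p.1| ≤ ε) (hq : s.height q.1 = q.2 ∨ t.height q.1 = q.2) :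
    q ∈ changedAt ε s t p := by
  refine ⟨h, ?_, ?_⟩
  · have := bump_nonneg ε p.1 q.1
    have := min_le_left (s.height q.1) (t.height q.1)
    have := min_le_right (s.height q.1) (t.height q.1)
    unfold lowerHeight
    rcases hq with hq | hq <;> linarith
  · have := bump_nonneg ε p.1 q.1
    have := le_max_left (s.height q.1) (t.height q.1)
    have := le_max_right (s.height q.1) (t.height q.1)
    unfold upperHeight
    rcases hq with hq | hq <;> linarith

/-- The changed neighbourhoods shrink to the resolved point. -/
theorem ResolvedAt.eventually_changedAt_subset {s t : UpperSemicircle} {p : ℝ × ℝ}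
    (h : s.ResolvedAt t p) {N : Set (ℝ × ℝ)} (hN : N ∈ 𝓝 p) :
    ∀ᶠ ε in 𝓝[>] (0 : ℝ), changedAt ε s t p ⊆ N := by
  obtain ⟨r, hr, hrN⟩ := Metric.mem_nhds_iff.1 hN
  have key : ∀ u : UpperSemicircle, p ∈ u.arc →
      ∃ δ > 0, ∀ a, |a - p.1| < δ → |u.height a - p.2| < r / 2 := by
    intro u hu
    have := Metric.continuous_iff.1 u.continuous_height p.1 (r / 2) (by positivity)
    rw [height_eq_of_mem_arc hu] at this
    exact this
  obtain ⟨d, hd, h1⟩ := key s h.mem_left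
  obtain ⟨e, he, h2⟩ := key t h.mem_right
  -- The heights contribute less than `r / 2` to the vertical displacement, and the bump at most `ε
  -- < r / 2`.
  filter_upwards [Ioo_mem_nhdsGT (show (0 : ℝ) < min (min d e) (r / 2) by positivity)]
    with ε hε q hq
  obtain ⟨hε0, hε1⟩ := hε
  simp only [lt_min_iff] at hε1
  obtain ⟨hq1, hq2, hq3⟩ := hq
  have hs := abs_lt.1 (h1 q.1 (by linarith))
  have ht := abs_lt.1 (h2 q.1 (by linarith))
  have hb := bump_of_le hq1
  have := abs_nonneg (q.1 - p.1)
  apply hrN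
  rw [Metric.mem_ball, Prod.dist_eq, max_lt_iff, Real.dist_eq, Real.dist_eq, abs_lt (a := q.2 - p.2)]
  refine ⟨by linarith, ?_, ?_⟩
  · rcases min_choice (s.height q.1) (t.height q.1) with h | h <;>
      rw [lowerHeight, h] at hq2 <;> linarith
  · rcases max_choice (s.height q.1) (t.height q.1) with h | h <;>
      rw [upperHeight, h] at hq3 <;> linarith

/-- If the branches met above the line, the bump would vanish and the semicircles would have a
common point there. That point lies over `p`, where the bump is `ε`. -/
theorem ResolvedAt.lowerHeight_lt_upperHeight {ε : ℝ} (hε : 0 < ε) {s t : UpperSemicircle}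
    {p : ℝ × ℝ} (h : s.ResolvedAt t p) {a : ℝ} (ha : |a - p.1| ≤ ε)
    (h0 : 0 < upperHeight ε p.1 s t a) : lowerHeight ε p.1 s t a < upperHeight ε p.1 s t a := by
  unfold lowerHeight upperHeight at *
  have hle := min_le_max (a := s.height a) (b := t.height a)
  by_contra hcon
  have hb0 := bump_nonneg ε p.1 a
  have hb : bump ε p.1 a = 0 := by linarith
  have hmm : min (s.height a) (t.height a) = max (s.height a) (t.height a) := by linarith
  have heq : s.height a = t.height a := le_antisymm
    ((le_max_left _ _).trans (hmm.symm.le.trans (min_le_right _ _)))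
    ((le_max_right _ _).trans (hmm.symm.le.trans (min_le_left _ _)))
  rw [hb, heq, max_self, add_zero] at h0
  have hs : (a, t.height a) ∈ s.arc := mem_arc_of_height_eq h0 heq
  have ht : (a, t.height a) ∈ t.arc := mem_arc_of_height_eq h0 rfl
  have := fst_eq_of_mem_arc h.1.ne hs ht h.mem_left h.mem_right
  simp only at this
  rw [bump_of_le ha, this, sub_self, abs_zero] at hb
  linarith

end UpperSemicircle

/-! ### Counting graphs above a point -/

/-- The indicator of the points strictly below the graph of `f`. -/
noncomputable def belowGraph (f : ℝ → ℝ) (q : ℝ × ℝ) : ℤ := if q.2 < f q.1 then 1 else 0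

theorem belowGraph_eq_zero_or_one (f : ℝ → ℝ) (q : ℝ × ℝ) :
    belowGraph f q = 0 ∨ belowGraph f q = 1 := by
  unfold belowGraph; split_ifs <;> simp

theorem eventually_belowGraph_eq {f : ℝ → ℝ} (hf : Continuous f) {q : ℝ × ℝ} (h : f q.1 ≠ q.2) :
    ∀ᶠ q' in 𝓝 q, belowGraph f q' = belowGraph f q := by
  rcases lt_or_gt_of_ne h with h | h
  · filter_upwards [(isOpen_lt (hf.comp continuous_fst) continuous_snd).mem_nhds h] with q' h'
    simp only [Function.comp] at h'
    simp [belowGraph, h'.not_gt, h.not_gt]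
  · filter_upwards [(isOpen_lt continuous_snd (hf.comp continuous_fst)).mem_nhds h] with q' h'
    simp only [Function.comp] at h'
    simp [belowGraph, h', h]

theorem eventually_sum_belowGraph_eq {ι : Type*} (I : Finset ι) {f : ι → ℝ → ℝ}
    (hf : ∀ i ∈ I, Continuous (f i)) {q : ℝ × ℝ} (h : ∀ i ∈ I, f i q.1 ≠ q.2) :
    ∀ᶠ q' in 𝓝 q, ∑ i ∈ I, belowGraph (f i) q' = ∑ i ∈ I, belowGraph (f i) q := by
  have : ∀ᶠ q' in 𝓝 q, ∀ i ∈ I, belowGraph (f i) q' = belowGraph (f i) q :=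
    (eventually_all_finset I).2 fun i hi => eventually_belowGraph_eq (hf i hi) (h i hi)
  filter_upwards [this] with q' h'
  exact Finset.sum_congr rfl h'

/-! ### Finiteness of the resolved points and the choice of scale -/

namespace SemicircleSeq

open UpperSemicircle

/-- The triples `(s, t, p)` such that the graph of `C` is resolved at the point `p` of `s` and
`t`. -/
def resolvedTriples (C : SemicircleSeq) : Set (UpperSemicircle × UpperSemicircle × (ℝ × ℝ)) :=
  {τ | τ.1 ∈ C.arcs ∧ τ.2.1 ∈ C.arcs ∧ τ.1.ResolvedAt τ.2.1 τ.2.2}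

/-- Semicircles with different centres share at most one point, so a triple is determined by its
pair of semicircles. -/
theorem finite_triples (C : SemicircleSeq) {P : UpperSemicircle → UpperSemicircle → ℝ × ℝ → Prop}
    (hP : ∀ s t p, P s t p → s.center ≠ t.center ∧ p ∈ s.arc ∧ p ∈ t.arc) :
    {τ : UpperSemicircle × UpperSemicircle × (ℝ × ℝ) |
      τ.1 ∈ C.arcs ∧ τ.2.1 ∈ C.arcs ∧ P τ.1 τ.2.1 τ.2.2}.Finite := by
  have hfin := (C.arcs ×ˢ C.arcs).finite_toSet
  refine Set.Finite.of_finite_image (f := fun τ => (τ.1, τ.2.1)) (hfin.subset ?_) ?_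
  · rintro _ ⟨τ, hτ, rfl⟩
    exact Finset.mem_coe.2 (Finset.mem_product.2 ⟨hτ.1, hτ.2.1⟩)
  · rintro ⟨s, t, p⟩ ⟨_, _, h⟩ ⟨s', t', p'⟩ ⟨_, _, h'⟩ heq
    obtain ⟨rfl, rfl⟩ := Prod.mk.inj heq
    obtain ⟨hc, h1, h2⟩ := hP _ _ _ h
    obtain ⟨-, h3, h4⟩ := hP _ _ _ h'
    have := eq_of_mem_arc hc h1 h2 h3 h4
    simp only at this
    rw [this]

theorem finite_resolvedTriples (C : SemicircleSeq) : C.resolvedTriples.Finite :=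
  C.finite_triples fun _ _ _ h => ⟨h.1.ne, h.mem_left, h.mem_right⟩

variable {C : SemicircleSeq}

theorem center_ne {s t : UpperSemicircle} (hs : s ∈ C.arcs) (ht : t ∈ C.arcs) (hst : s ≠ t) :
    s.center ≠ t.center :=
  fun h => hst (C.center_injOn hs ht h)

theorem mem_resolvedTriples_of_crossAt {s t : UpperSemicircle} {p : ℝ × ℝ}
    (hs : s ∈ C.arcs) (ht : t ∈ C.arcs) (h : s.CrossAt t p) :
    (s, t, p) ∈ C.resolvedTriples ∨ (t, s, p) ∈ C.resolvedTriples := by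
  rcases lt_or_gt_of_ne (center_ne hs ht h.1) with hc | hc
  · exact Or.inl ⟨hs, ht, hc, Or.inl h⟩
  · exact Or.inr ⟨ht, hs, hc, Or.inl h.symm⟩

theorem mem_resolvedTriples_of_veeAt {s t : UpperSemicircle} {p : ℝ × ℝ}
    (hs : s ∈ C.arcs) (ht : t ∈ C.arcs) (h : s.VeeAt t p) : (s, t, p) ∈ C.resolvedTriples :=
  ⟨hs, ht, h.center_lt, Or.inr h⟩

theorem eq_or_eq_of_mem_arc (hC : ∀ p : ℝ × ℝ, {s | s ∈ C.arcs ∧ p ∈ s.arc}.encard ≤ 2)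
    {s t u : UpperSemicircle} {p : ℝ × ℝ} (hs : s ∈ C.arcs) (ht : t ∈ C.arcs) (hu : u ∈ C.arcs)
    (hst : s ≠ t) (hps : p ∈ s.arc) (hpt : p ∈ t.arc) (hpu : p ∈ u.arc) : u = s ∨ u = t := by
  by_contra! hne
  have hsub : ({u, s, t} : Set UpperSemicircle) ⊆ {s | s ∈ C.arcs ∧ p ∈ s.arc} := by
    rintro v (rfl | rfl | rfl)
    exacts [⟨hu, hpu⟩, ⟨hs, hps⟩, ⟨ht, hpt⟩]
  have h := (Set.encard_le_encard hsub).trans (hC p)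
  rw [Set.encard_insert_of_notMem (by simp [hne.1, hne.2]), Set.encard_pair hst] at h
  norm_num at h

/-- Only two semicircles pass through the point, and the order of the centres fixes their roles.
Thus each resolved point is corrected for exactly once. -/
theorem eq_of_mem_resolvedTriples
    (hC : ∀ p : ℝ × ℝ, {s | s ∈ C.arcs ∧ p ∈ s.arc}.encard ≤ 2)
    {τ τ' : UpperSemicircle × UpperSemicircle × (ℝ × ℝ)} (hτ : τ ∈ C.resolvedTriples)
    (hτ' : τ' ∈ C.resolvedTriples) (h : τ.2.2 = τ'.2.2) : τ = τ' := by
  obtain ⟨s, t, p⟩ := τ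
  obtain ⟨s', t', p'⟩ := τ'
  obtain ⟨hs, ht, hr⟩ := hτ
  obtain ⟨hs', ht', hr'⟩ := hτ'
  simp only at *
  subst h
  have hne : s ≠ t := fun h => hr.1.ne (congrArg _ h)
  have h1 := eq_or_eq_of_mem_arc hC hs ht hs' hne hr.mem_left hr.mem_right hr'.mem_left
  have h2 := eq_or_eq_of_mem_arc hC hs ht ht' hne hr.mem_left hr.mem_right hr'.mem_right
  have hl := hr.1
  have hl' := hr'.1
  rcases h1 with rfl | rfl <;> rcases h2 with rfl | rfl
  · exact absurd hl' (lt_irrefl _)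
  · rfl
  · exact absurd hl' hl.not_gt
  · exact absurd hl' (lt_irrefl _)

/-- The scale `ε` is so small that the changed neighbourhoods do not interfere with one another
or with other semicircles. -/
structure IsSmall (C : SemicircleSeq) (ε : ℝ) : Prop where
  pos : 0 < ε
  arc_disjoint : ∀ τ ∈ C.resolvedTriples, ∀ u ∈ C.arcs, ∀ q ∈ changedAt ε τ.1 τ.2.1 τ.2.2,
    q ∈ u.arc → u = τ.1 ∨ u = τ.2.1
  disjoint : ∀ τ ∈ C.resolvedTriples, ∀ τ' ∈ C.resolvedTriples,
    ∀ q ∈ changedAt ε τ.1 τ.2.1 τ.2.2, q ∈ changedAt ε τ'.1 τ'.2.1 τ'.2.2 → τ = τ'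
  fst_eq : ∀ τ ∈ C.resolvedTriples, ∀ τ' ∈ C.resolvedTriples, ∀ a : ℝ,
    |a - τ.2.2.1| ≤ ε → |a - τ'.2.2.1| ≤ ε → τ.2.2.1 = τ'.2.2.1

/-- By finiteness each condition needs checking only for fixed triples and arcs. Neighbourhoods
shrinking to a point leave any arc not through it and separate from those of other points; arcs
through the point are handled by `hC`. -/
theorem eventually_isSmall (hC : ∀ p : ℝ × ℝ, {s | s ∈ C.arcs ∧ p ∈ s.arc}.encard ≤ 2) :
    ∀ᶠ ε in 𝓝[>] (0 : ℝ), C.IsSmall ε := by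
  have hfin := C.finite_resolvedTriples
  have h1 : ∀ᶠ ε in 𝓝[>] (0 : ℝ), ∀ τ ∈ C.resolvedTriples, ∀ u ∈ C.arcs,
      ∀ q ∈ changedAt ε τ.1 τ.2.1 τ.2.2, q ∈ u.arc → u = τ.1 ∨ u = τ.2.1 := by
    refine (eventually_all_finite hfin).2 fun τ hτ => (eventually_all_finset _).2 fun u hu => ?_
    by_cases hp : τ.2.2 ∈ u.arc
    · exact Eventually.of_forall fun ε q _ _ => eq_or_eq_of_mem_arc hC hτ.1 hτ.2.1 hu
        (fun h => hτ.2.2.1.ne (congrArg _ h)) hτ.2.2.mem_left hτ.2.2.mem_right hp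
    · filter_upwards [hτ.2.2.eventually_changedAt_subset
        (u.isClosed_arc.isOpen_compl.mem_nhds hp)] with ε h q hq hqu
      exact absurd hqu (h hq)
  have h2 : ∀ᶠ ε in 𝓝[>] (0 : ℝ), ∀ τ ∈ C.resolvedTriples, ∀ τ' ∈ C.resolvedTriples,
      ∀ q ∈ changedAt ε τ.1 τ.2.1 τ.2.2, q ∈ changedAt ε τ'.1 τ'.2.1 τ'.2.2 → τ = τ' := by
    refine (eventually_all_finite hfin).2 fun τ hτ => (eventually_all_finite hfin).2
      fun τ' hτ' => ?_
    by_cases hp : τ.2.2 = τ'.2.2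
    · exact Eventually.of_forall fun ε q _ _ => eq_of_mem_resolvedTriples hC hτ hτ' hp
    · obtain ⟨U, V, hU, hV, hd⟩ := t2_separation_nhds hp
      filter_upwards [hτ.2.2.eventually_changedAt_subset hU,
        hτ'.2.2.eventually_changedAt_subset hV] with ε h h' q hq hq'
      exact absurd (h' hq') (Set.disjoint_left.1 hd (h hq))
  have h3 : ∀ᶠ ε in 𝓝[>] (0 : ℝ), ∀ τ ∈ C.resolvedTriples, ∀ τ' ∈ C.resolvedTriples, ∀ a : ℝ,
      |a - τ.2.2.1| ≤ ε → |a - τ'.2.2.1| ≤ ε → τ.2.2.1 = τ'.2.2.1 := by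
    refine (eventually_all_finite hfin).2 fun τ hτ => (eventually_all_finite hfin).2
      fun τ' hτ' => ?_
    by_cases hp : τ.2.2.1 = τ'.2.2.1
    · exact Eventually.of_forall fun _ _ _ _ => hp
    -- Below half the distance of the abscissae, the closed strips of half-width `ε` are disjoint.
    · filter_upwards [Ioo_mem_nhdsGT (show (0 : ℝ) < |τ.2.2.1 - τ'.2.2.1| / 2 from
        half_pos (abs_pos.2 (sub_ne_zero.2 hp)))] with ε hε a h h'
      have := abs_sub_le τ.2.2.1 a τ'.2.2.1
      rw [abs_sub_comm] at h
      linarith [hε.2]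
  filter_upwards [h1, h2, h3, self_mem_nhdsWithin] with ε h1 h2 h3 h0
  exact ⟨h0, h1, h2, h3⟩

/-! ### The resolved depth and its local behaviour -/

/-- The change in the number of curves above `q` caused by the resolution at `p`. -/
noncomputable def depthCorrection (ε : ℝ) (s t : UpperSemicircle) (p q : ℝ × ℝ) : ℤ :=
  belowGraph (upperHeight ε p.1 s t) q + belowGraph (lowerHeight ε p.1 s t) q
    - belowGraph s.height q - belowGraph t.height q

/-- Replacing two graphs by their maximum and minimum preserves the count. Outside the neighbourhood
either the bump vanishes, or the point is below all four graphs or above all four. -/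
theorem depthCorrection_eq_zero {ε : ℝ} {s t : UpperSemicircle} {p q : ℝ × ℝ}
    (h : q ∉ changedAt ε s t p) : depthCorrection ε s t p q = 0 := by
  have hm : belowGraph s.height q + belowGraph t.height q =
      belowGraph (fun a => max (s.height a) (t.height a)) q +
        belowGraph (fun a => min (s.height a) (t.height a)) q := by
    rcases le_total (s.height q.1) (t.height q.1) with h | h <;> simp [belowGraph, h, add_comm]
  rw [depthCorrection, sub_sub, hm]
  have hb := bump_nonneg ε p.1 q.1
  have hle := min_le_max (a := s.height q.1) (b := t.height q.1)
  by_cases h1 : |q.1 - p.1| ≤ ε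
  · have h2 : q.2 < lowerHeight ε p.1 s t q.1 ∨ upperHeight ε p.1 s t q.1 < q.2 := by
      by_contra! hcon
      exact h ⟨h1, hcon⟩
    unfold lowerHeight upperHeight at h2
    unfold lowerHeight upperHeight belowGraph
    simp only
    rcases h2 with h2 | h2
    · rw [if_pos, if_pos, if_pos, if_pos] <;> linarith
    · rw [if_neg, if_neg, if_neg, if_neg] <;> linarith
  · have := bump_of_lt (not_le.1 h1)
    simp [belowGraph, upperHeight, lowerHeight, this]

/-- The number of curves of the resolved drawing above `q`. -/
noncomputable def resolvedDepth (C : SemicircleSeq) (ε : ℝ) (q : ℝ × ℝ) : ℤ :=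
  ∑ s ∈ C.arcs, belowGraph s.height q +
    ∑ τ ∈ C.finite_resolvedTriples.toFinset, depthCorrection ε τ.1 τ.2.1 τ.2.2 q

theorem resolvedDepth_eq_of_notMem {ε : ℝ} {q : ℝ × ℝ}
    (h : ∀ τ ∈ C.resolvedTriples, q ∉ changedAt ε τ.1 τ.2.1 τ.2.2) :
    C.resolvedDepth ε q = ∑ s ∈ C.arcs, belowGraph s.height q := by
  rw [resolvedDepth, add_eq_left]
  refine Finset.sum_eq_zero fun τ hτ => ?_
  exact depthCorrection_eq_zero (h τ (by simpa using hτ))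

theorem circleDepth_eq_sum {q : ℝ × ℝ} (h0 : 0 < q.2) :
    (C.circleDepth q : ℤ) = ∑ s ∈ C.arcs, belowGraph s.height q := by
  classical
  have : {s | s ∈ C.arcs ∧ s.IsAbove q} =
      ((C.arcs.filter fun s => q.2 < s.height q.1 : Finset _) : Set UpperSemicircle) := by
    ext s
    simp [isAbove_iff h0]
  rw [circleDepth, this, Set.ncard_coe_finset, Finset.card_filter]
  push_cast
  rfl

theorem notMem_changedAt_of_notMem_changedRegion {ε : ℝ} {q : ℝ × ℝ} (h0 : 0 < q.2)
    (h : q ∉ C.changedRegion ε) :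
    ∀ τ ∈ C.resolvedTriples, q ∉ changedAt ε τ.1 τ.2.1 τ.2.2 := by
  rintro ⟨s, t, p⟩ ⟨hs, ht, hr⟩ ⟨h1, h2, h3⟩
  simp only [lowerHeight, upperHeight, bump_of_le h1] at *
  rcases hr.2 with hc | hv
  · exact h (Or.inl ⟨s, hs, t, ht, p, hc, h1, h2, h3⟩)
  · exact h (Or.inr ⟨s, hs, t, ht, p, hv, h1, h0.le, h3⟩)

/-- Near a point above the line, `resolvedDepth` counts the graphs above a point in a finite
family of continuous functions, at most one of which passes through the given point, and none
if that point is not on the resolved drawing. -/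
theorem IsSmall.exists_local_sum (hC : ∀ p : ℝ × ℝ, {s | s ∈ C.arcs ∧ p ∈ s.arc}.encard ≤ 2)
    {ε : ℝ} (hε : C.IsSmall ε) {q : ℝ × ℝ} (h0 : 0 < q.2) :
    ∃ (g : ℝ × ℝ → ℤ) (f : ℝ → ℝ), (∀ᶠ q' in 𝓝 q, g q' = g q) ∧ Continuous f ∧
      (∀ᶠ q' in 𝓝 q, C.resolvedDepth ε q' = g q' + belowGraph f q') ∧
      (q ∉ (C.resolvedGraph ε).carrier → f q.1 ≠ q.2) := by
  classical
  by_cases hR : ∃ τ ∈ C.resolvedTriples, q ∈ changedAt ε τ.1 τ.2.1 τ.2.2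
  · obtain ⟨⟨s, t, p⟩, hτ, hq⟩ := hR
    obtain ⟨hs, ht, hr⟩ := id hτ
    simp only at hs ht hr hq
    have hne : s ≠ t := fun h => hr.1.ne (congrArg _ h)
    have hother : ∀ᶠ q' in 𝓝 q, ∀ τ ∈ C.resolvedTriples, τ ≠ (s, t, p) →
        q' ∉ changedAt ε τ.1 τ.2.1 τ.2.2 := by
      refine (eventually_all_finite C.finite_resolvedTriples).2 fun τ hτ' => ?_
      by_cases he : τ = (s, t, p)
      · exact Eventually.of_forall fun _ h => absurd he h
      · filter_upwards [(isClosed_changedAt ε τ.1 τ.2.1 τ.2.2).isOpen_compl.mem_nhds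
          (fun h => he (hε.disjoint τ hτ' _ hτ q h hq))] with q' h _
        exact h
    -- The single surviving correction cancels the terms of `s` and `t` and puts the two branches in
    -- their place.
    have hsum : ∀ᶠ q' in 𝓝 q, C.resolvedDepth ε q' =
        ∑ u ∈ (C.arcs.erase s).erase t, belowGraph u.height q' +
          belowGraph (upperHeight ε p.1 s t) q' + belowGraph (lowerHeight ε p.1 s t) q' := by
      filter_upwards [hother] with q' h
      rw [resolvedDepth, Finset.sum_eq_single (s, t, p)]
      · rw [← Finset.add_sum_erase _ _ hs,
          ← Finset.add_sum_erase _ _ (Finset.mem_erase.2 ⟨hne.symm, ht⟩), depthCorrection]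
        ring
      · intro τ hτ' he
        exact depthCorrection_eq_zero (h τ (by simpa using hτ') he)
      · intro h'
        exact absurd (by simpa using hτ) h'
    have hrest : ∀ᶠ q' in 𝓝 q, ∑ u ∈ (C.arcs.erase s).erase t, belowGraph u.height q' =
        ∑ u ∈ (C.arcs.erase s).erase t, belowGraph u.height q := by
      refine eventually_sum_belowGraph_eq _ (fun u _ => u.continuous_height) fun u hu heq => ?_
      simp only [Finset.mem_erase] at hu
      rcases hε.arc_disjoint _ hτ u hu.2.2 q hq (mem_arc_of_height_eq h0 heq) with h | h
      exacts [hu.2.1 h, hu.1 h]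
    have hcarrier : lowerHeight ε p.1 s t q.1 = q.2 ∨ upperHeight ε p.1 s t q.1 = q.2 →
        q ∈ (C.resolvedGraph ε).carrier := by
      have hb := bump_of_le hq.1
      simp only [lowerHeight, upperHeight, hb]
      rcases hr.2 with hc | hv
      · rintro (h | h)
        · exact Or.inr (Or.inl ⟨s, hs, t, ht, p, hc, Or.inr (Or.inl ⟨hq.1, h.symm⟩)⟩)
        · exact Or.inr (Or.inl ⟨s, hs, t, ht, p, hc, Or.inl ⟨hq.1, h.symm⟩⟩)
      · rintro (h | h)
        -- At a V the lower branch has height at most `0`, so it misses `q`.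
        · rw [hv.min_height] at h
          linarith [hq.1]
        · exact Or.inr (Or.inr ⟨s, hs, t, ht, p, hv, Or.inl ⟨hq.1, h.symm⟩⟩)
    by_cases hu : upperHeight ε p.1 s t q.1 = q.2
    · have hl : lowerHeight ε p.1 s t q.1 ≠ q.2 := by
        have := hr.lowerHeight_lt_upperHeight hε.pos hq.1 (hu ▸ h0)
        linarith
      refine ⟨fun q' => ∑ u ∈ (C.arcs.erase s).erase t, belowGraph u.height q' +
        belowGraph (lowerHeight ε p.1 s t) q', upperHeight ε p.1 s t, ?_,
        continuous_upperHeight _ _ _ _, ?_, fun h => absurd (hcarrier (Or.inr hu)) h⟩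
      · filter_upwards [hrest, eventually_belowGraph_eq (continuous_lowerHeight _ _ _ _) hl]
          with q' h1 h2
        rw [h1, h2]
      · filter_upwards [hsum] with q' h
        rw [h]; ring
    · refine ⟨fun q' => ∑ u ∈ (C.arcs.erase s).erase t, belowGraph u.height q' +
        belowGraph (upperHeight ε p.1 s t) q', lowerHeight ε p.1 s t, ?_,
        continuous_lowerHeight _ _ _ _, hsum, fun h h' => h (hcarrier (Or.inl h'))⟩
      filter_upwards [hrest, eventually_belowGraph_eq (continuous_upperHeight _ _ _ _) hu]
        with q' h1 h2
      rw [h1, h2]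
  · push Not at hR
    have hloc : ∀ᶠ q' in 𝓝 q, C.resolvedDepth ε q' = ∑ s ∈ C.arcs, belowGraph s.height q' := by
      have : ∀ᶠ q' in 𝓝 q, ∀ τ ∈ C.resolvedTriples, q' ∉ changedAt ε τ.1 τ.2.1 τ.2.2 :=
        (eventually_all_finite C.finite_resolvedTriples).2 fun τ hτ =>
          (isClosed_changedAt ε τ.1 τ.2.1 τ.2.2).isOpen_compl.mem_nhds (hR τ hτ)
      filter_upwards [this] with q' h
      exact resolvedDepth_eq_of_notMem h
    by_cases hs : ∃ s ∈ C.arcs, s.height q.1 = q.2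
    · obtain ⟨s, hs, hsq⟩ := hs
      refine ⟨fun q' => ∑ u ∈ C.arcs.erase s, belowGraph u.height q', s.height, ?_,
        s.continuous_height, ?_, ?_⟩
      -- A second semicircle through `q` would make `q` a crossing, which lies in its own changed
      -- neighbourhood.
      · refine eventually_sum_belowGraph_eq _ (fun u _ => u.continuous_height) fun u hu heq => ?_
        obtain ⟨hus, hu⟩ := Finset.mem_erase.1 hu
        have hcr : u.CrossAt s q := ⟨hus, mem_arc_of_height_eq h0 heq,
          mem_arc_of_height_eq h0 hsq, h0⟩
        rcases mem_resolvedTriples_of_crossAt hu hs hcr with h | h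
        · exact hR _ h (mem_changedAt_of_height_eq (by simpa using hε.pos.le) (Or.inl heq))
        · exact hR _ h (mem_changedAt_of_height_eq (by simpa using hε.pos.le) (Or.inl hsq))
      · filter_upwards [hloc] with q' h
        rw [h, ← Finset.sum_erase_add _ _ hs]
      · intro hcar
        refine absurd (Or.inl ⟨s, hs, mem_arc_of_height_eq h0 hsq, ?_⟩) hcar
        rintro p ⟨u, hu, v, hv, hp⟩ hps
        by_contra! hlt
        obtain ⟨τ, hτ, hτp⟩ : ∃ τ ∈ C.resolvedTriples, τ.2.2 = p := by
          rcases hp with hp | hp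
          · rcases mem_resolvedTriples_of_crossAt hu hv hp with h | h <;> exact ⟨_, h, rfl⟩
          · exact ⟨_, mem_resolvedTriples_of_veeAt hu hv hp, rfl⟩
        obtain ⟨h1, h2, hr⟩ := id hτ
        subst hτp
        -- A resolved point of `s` at distance less than `ε` would place `q` in its changed
        -- neighbourhood.
        refine hR τ hτ (mem_changedAt_of_height_eq hlt.le ?_)
        rcases eq_or_eq_of_mem_arc hC h1 h2 hs (fun h => hr.1.ne (congrArg _ h))
          hr.mem_left hr.mem_right hps with h | h
        · exact Or.inl (h ▸ hsq)
        · exact Or.inr (h ▸ hsq)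
    · push Not at hs
      -- No graph passes through `q`; the constant `q.2 - 1` is a dummy that contributes `0` near
      -- `q`.
      refine ⟨fun q' => ∑ u ∈ C.arcs, belowGraph u.height q', fun _ => q.2 - 1,
        eventually_sum_belowGraph_eq _ (fun u _ => u.continuous_height) hs, continuous_const,
        ?_, fun _ => by simp⟩
      filter_upwards [hloc, (isOpen_lt (continuous_const (y := q.2 - 1)) continuous_snd).mem_nhds
        (show q.2 - 1 < q.2 by linarith)] with q' h h'
      rw [h, belowGraph, if_neg (by exact not_lt.2 (le_of_lt h')), add_zero]

end SemicircleSeq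

/-! ### Crossings of a path and jumps of an integer function -/

namespace HalfPlaneGraph

theorem crossingNumber_eq (G : HalfPlaneGraph) {x z : ℝ × ℝ} (γ : Path x z) :
    G.crossingNumber γ = {t | γ t ∈ G.carrier \ G.vertices}.encard := by
  unfold crossingNumber
  congr 1
  ext t
  constructor
  · rintro ⟨_, ⟨q, _, rfl⟩, ht⟩
    exact connectedComponentIn_subset (G.carrier \ G.vertices) q ht
  · intro ht
    exact ⟨_, ⟨_, ht, rfl⟩, mem_connectedComponentIn ht⟩

end HalfPlaneGraph

/-- An integer valued function on the unit interval that nowhere jumps by more than one has at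
least as many jumps as it has values to pass. -/
theorem le_encard_of_locally_two_valued {f : unitInterval → ℤ} {T : Set unitInterval} {d : ℕ}
    (h0 : f 0 = d) (h1 : f 1 = 0)
    (hf : ∀ t, ∃ k, ∀ᶠ t' in 𝓝 t, f t' = k ∨ f t' = k + 1)
    (hT : ∀ t ∉ T, ∀ᶠ t' in 𝓝 t, f t' = f t) : (d : ℕ∞) ≤ T.encard := by
  -- The set where `f` exceeds `k` contains `0` but not `1`, so by connectedness it has a frontier
  -- point.
  have key : ∀ k : Fin d, ∃ t, t ∈ frontier {t | (k : ℤ) < f t} := by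
    intro k
    refine nonempty_frontier_iff.2 ⟨⟨0, ?_⟩, fun h => ?_⟩
    · change (k : ℤ) < f 0
      rw [h0]; exact_mod_cast k.2
    · have : (1 : unitInterval) ∈ {t | (k : ℤ) < f t} := h ▸ Set.mem_univ _
      change (k : ℤ) < f 1 at this
      rw [h1] at this
      omega
  choose t ht using key
  have hfreq : ∀ k : Fin d, (∃ᶠ t' in 𝓝 (t k), (k : ℤ) < f t') ∧ ∃ᶠ t' in 𝓝 (t k), ¬ (k : ℤ) < f t' := by
    intro k
    have := ht k
    rw [frontier_eq_closure_inter_closure] at this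
    exact ⟨mem_closure_iff_frequently.1 this.1, mem_closure_iff_frequently.1 this.2⟩
  -- Values above `k` and values at most `k` both occur near `t k`, which forces the local pair to
  -- be `k` and `k + 1`. Hence `t k` determines `k`.
  have hval : ∀ k : Fin d, ∀ j : ℤ, (∀ᶠ t' in 𝓝 (t k), f t' = j ∨ f t' = j + 1) → j = k := by
    intro k j hj
    obtain ⟨a, ha, ha'⟩ := ((hfreq k).1.and_eventually hj).exists
    obtain ⟨b, hb, hb'⟩ := ((hfreq k).2.and_eventually hj).exists
    omega
  have hinj : Function.Injective t := by
    intro k k' h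
    obtain ⟨j, hj⟩ := hf (t k)
    have e1 := hval k j hj
    have e2 := hval k' j (h ▸ hj)
    exact Fin.ext (by omega)
  have hmem : Set.range t ⊆ T := by
    rintro _ ⟨k, rfl⟩
    by_contra hk
    have := hT _ hk
    obtain ⟨a, ha, ha'⟩ := ((hfreq k).1.and_eventually this).exists
    obtain ⟨b, hb, hb'⟩ := ((hfreq k).2.and_eventually this).exists
    omega
  refine le_trans ?_ (Set.encard_le_encard hmem)
  rw [← Set.image_univ, hinj.encard_image]
  simp

/-! ### The lower bound for the path depth -/

namespace SemicircleSeq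

open UpperSemicircle HalfPlaneGraph

variable {C : SemicircleSeq} {ε : ℝ}

theorem IsSmall.eventually_two_values
    (hC : ∀ p : ℝ × ℝ, {s | s ∈ C.arcs ∧ p ∈ s.arc}.encard ≤ 2) (hε : C.IsSmall ε)
    {q : ℝ × ℝ} (h0 : 0 < q.2) :
    ∃ k, ∀ᶠ q' in 𝓝 q, C.resolvedDepth ε q' = k ∨ C.resolvedDepth ε q' = k + 1 := by
  obtain ⟨g, f, hg, -, hD, -⟩ := hε.exists_local_sum hC h0
  refine ⟨g q, ?_⟩
  filter_upwards [hg, hD] with q' h1 h2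
  rw [h2, h1]
  rcases belowGraph_eq_zero_or_one f q' with h | h <;> simp [h]

theorem IsSmall.eventually_resolvedDepth_eq
    (hC : ∀ p : ℝ × ℝ, {s | s ∈ C.arcs ∧ p ∈ s.arc}.encard ≤ 2) (hε : C.IsSmall ε)
    {q : ℝ × ℝ} (h0 : 0 < q.2) (hq : q ∉ (C.resolvedGraph ε).carrier) :
    ∀ᶠ q' in 𝓝 q, C.resolvedDepth ε q' = C.resolvedDepth ε q := by
  obtain ⟨g, f, hg, hf, hD, hne⟩ := hε.exists_local_sum hC h0
  filter_upwards [hg, hD, eventually_belowGraph_eq hf (hne hq)] with q' h1 h2 h3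
  rw [h2, h1, h3, hD.self_of_nhds]

/-- A nonzero count requires a changed neighbourhood or a semicircle overhead. The condition `0 <
q.2` is essential, since points under the line lie below every height function. -/
theorem isBounded_resolvedDepth_ne_zero :
    Bornology.IsBounded {q : ℝ × ℝ | 0 < q.2 ∧ C.resolvedDepth ε q ≠ 0} := by
  have h1 : Bornology.IsBounded (⋃ τ ∈ C.resolvedTriples,
      {q : ℝ × ℝ | 0 < q.2 ∧ q ∈ changedAt ε τ.1 τ.2.1 τ.2.2}) := by
    refine (Bornology.isBounded_biUnion C.finite_resolvedTriples).2 fun τ _ => ?_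
    refine (Metric.isBounded_Icc (τ.2.2.1 - ε, (0 : ℝ))
      (τ.2.2.1 + ε, max τ.1.radius τ.2.1.radius + ε)).subset ?_
    rintro q ⟨h0, h1, -, h3⟩
    rw [upperHeight, bump_of_le h1] at h3
    have := max_le_max (τ.1.height_le_radius q.1) (τ.2.1.height_le_radius q.1)
    have h4 := abs_le.1 h1
    have := abs_nonneg (q.1 - τ.2.2.1)
    exact ⟨⟨by simp only; linarith, h0.le⟩, ⟨by simp only; linarith, by simp only; linarith⟩⟩
  have h2 : Bornology.IsBounded (⋃ s ∈ (C.arcs : Set UpperSemicircle),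
      {q : ℝ × ℝ | 0 < q.2 ∧ q.2 < s.height q.1}) := by
    refine (Bornology.isBounded_biUnion C.arcs.finite_toSet).2 fun s _ => ?_
    refine (Metric.isBounded_Icc (s.center - s.radius, (0 : ℝ))
      (s.center + s.radius, s.radius)).subset ?_
    rintro q ⟨h0, h1⟩
    have h2 := s.height_le_radius q.1
    have h3 := abs_le.1 (abs_le_of_sq_le_sq (sub_nonneg.1 (Real.sqrt_pos.1 (h0.trans h1)).le)
      s.radius_pos.le)
    exact ⟨⟨by simp only; linarith, h0.le⟩, ⟨by simp only; linarith, by simp only; linarith⟩⟩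
  refine (h1.union h2).subset ?_
  rintro q ⟨h0, hq⟩
  by_contra hcon
  simp only [Set.mem_union, Set.mem_iUnion, not_or, not_exists] at hcon
  refine hq ?_
  rw [resolvedDepth_eq_of_notMem fun τ hτ h => hcon.1 τ hτ ⟨h0, h⟩]
  refine Finset.sum_eq_zero fun s hs => ?_
  rw [belowGraph, if_neg fun h => hcon.2 s hs ⟨h0, h⟩]

/-- The count is constant on a face, so a nonzero value would confine the face to a bounded set. -/
theorem IsSmall.resolvedDepth_eq_zero
    (hC : ∀ p : ℝ × ℝ, {s | s ∈ C.arcs ∧ p ∈ s.arc}.encard ≤ 2) (hε : C.IsSmall ε)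
    {F : Set (ℝ × ℝ)} (hF : F ∈ (C.resolvedGraph ε).faces) (hb : ¬ Bornology.IsBounded F)
    {z : ℝ × ℝ} (hz : z ∈ F) : C.resolvedDepth ε z = 0 := by
  obtain ⟨q, -, rfl⟩ := hF
  by_contra hne
  refine hb ((isBounded_resolvedDepth_ne_zero (C := C) (ε := ε)).subset fun w hw => ?_)
  have hsub := connectedComponentIn_subset (C.resolvedGraph ε).faceRegion q
  have hcont : ContinuousOn (C.resolvedDepth ε)
      (connectedComponentIn (C.resolvedGraph ε).faceRegion q) := fun v hv =>
    ContinuousAt.continuousWithinAt <| tendsto_nhds_of_eventually_eq <|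
      hε.eventually_resolvedDepth_eq hC (hsub hv).1 fun h => (hsub hv).2 (Or.inl h)
  refine ⟨(hsub hw).1, ?_⟩
  rwa [isPreconnected_connectedComponentIn.constant hcont hw hz]

theorem IsSmall.circleDepth_le_crossingNumber
    (hC : ∀ p : ℝ × ℝ, {s | s ∈ C.arcs ∧ p ∈ s.arc}.encard ≤ 2) (hε : C.IsSmall ε)
    {x : ℝ × ℝ} (h0 : 0 < x.2) (hx : x ∉ C.changedRegion ε)
    {F : Set (ℝ × ℝ)} (hF : F ∈ (C.resolvedGraph ε).faces) (hb : ¬ Bornology.IsBounded F)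
    {z : ℝ × ℝ} (hz : z ∈ F) (γ : Path x z) (hγ : (C.resolvedGraph ε).IsAdmissible γ) :
    (C.circleDepth x : ℕ∞) ≤ (C.resolvedGraph ε).crossingNumber γ := by
  rw [crossingNumber_eq]
  refine le_encard_of_locally_two_valued (f := fun t => C.resolvedDepth ε (γ t)) ?_ ?_ ?_ ?_
  · simp only [γ.source]
    rw [circleDepth_eq_sum h0,
      resolvedDepth_eq_of_notMem (notMem_changedAt_of_notMem_changedRegion h0 hx)]
  · simp only [γ.target]
    exact hε.resolvedDepth_eq_zero hC hF hb hz
  · intro t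
    obtain ⟨k, hk⟩ := hε.eventually_two_values hC (hγ t).1
    exact ⟨k, γ.continuous.continuousAt.eventually hk⟩
  · intro t ht
    exact γ.continuous.continuousAt.eventually (hε.eventually_resolvedDepth_eq hC (hγ t).1
      fun h => ht ⟨h, (hγ t).2⟩)

end SemicircleSeq

namespace UpperSemicircle

theorem changedAt_comm (ε : ℝ) (s t : UpperSemicircle) (p : ℝ × ℝ) :
    changedAt ε s t p = changedAt ε t s p := by
  simp only [changedAt, upperHeight, lowerHeight, max_comm, min_comm]

end UpperSemicircle

/-! ### Closedness of the resolved drawing and its unbounded face -/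

namespace SemicircleSeq

open UpperSemicircle HalfPlaneGraph

variable {C : SemicircleSeq} {ε : ℝ}

theorem isClosed_iUnion_triples {P : UpperSemicircle → UpperSemicircle → ℝ × ℝ → Prop}
    (hP : ∀ s ∈ C.arcs, ∀ t ∈ C.arcs, ∀ p, P s t p →
      s.center ≠ t.center ∧ p ∈ s.arc ∧ p ∈ t.arc)
    {A : UpperSemicircle → UpperSemicircle → ℝ × ℝ → ℝ × ℝ → Prop}
    (hA : ∀ s t p, IsClosed {q | A s t p q}) :
    IsClosed {q | ∃ s ∈ C.arcs, ∃ t ∈ C.arcs, ∃ p, P s t p ∧ A s t p q} := by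
  -- Membership in `C.arcs` is built into the predicate because `hP` is available only for those
  -- semicircles.
  have hfin := C.finite_triples (P := fun s t p => s ∈ C.arcs ∧ t ∈ C.arcs ∧ P s t p)
    fun s t p h => hP s h.1 t h.2.1 p h.2.2
  convert hfin.isClosed_biUnion fun τ _ => hA τ.1 τ.2.1 τ.2.2 using 1
  ext q
  simp only [Set.mem_iUnion]
  constructor
  · rintro ⟨s, hs, t, ht, p, hp, hq⟩
    exact ⟨(s, t, p), ⟨hs, ht, hs, ht, hp⟩, hq⟩
  · rintro ⟨⟨s, t, p⟩, ⟨hs, ht, -, -, hp⟩, hq⟩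
    exact ⟨s, hs, t, ht, p, hp, hq⟩

theorem crossAt_triple {s t : UpperSemicircle} (hs : s ∈ C.arcs) (ht : t ∈ C.arcs) {p : ℝ × ℝ}
    (h : s.CrossAt t p) : s.center ≠ t.center ∧ p ∈ s.arc ∧ p ∈ t.arc :=
  ⟨center_ne hs ht h.1, h.2.1, h.2.2.1⟩

theorem veeAt_triple {s t : UpperSemicircle} {p : ℝ × ℝ}
    (h : s.VeeAt t p) : s.center ≠ t.center ∧ p ∈ s.arc ∧ p ∈ t.arc :=
  ⟨h.center_lt.ne, h.1 ▸ s.rightEnd_mem_arc, h.2 ▸ t.leftEnd_mem_arc⟩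

theorem isClosed_upperBranch (ε : ℝ) (s t : UpperSemicircle) (p : ℝ × ℝ) :
    IsClosed (upperBranch ε s t p) := by
  have hs := s.continuous_height
  have ht := t.continuous_height
  have h1 : IsClosed {q : ℝ × ℝ | |q.1 - p.1| ≤ ε} := isClosed_le (by fun_prop) (by fun_prop)
  exact h1.inter (isClosed_eq (by fun_prop) (by fun_prop))

theorem isClosed_lowerBranch (ε : ℝ) (s t : UpperSemicircle) (p : ℝ × ℝ) :
    IsClosed (lowerBranch ε s t p) := by
  have hs := s.continuous_height
  have ht := t.continuous_height
  have h1 : IsClosed {q : ℝ × ℝ | |q.1 - p.1| ≤ ε} := isClosed_le (by fun_prop) (by fun_prop)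
  exact h1.inter (isClosed_eq (by fun_prop) (by fun_prop))

theorem isClosed_verticalEdge (a h k : ℝ) : IsClosed (verticalEdge a h k) := by
  have h1 : IsClosed {q : ℝ × ℝ | q.1 = a} := isClosed_eq (by fun_prop) (by fun_prop)
  have h2 : IsClosed {q : ℝ × ℝ | h ≤ q.2} := isClosed_le (by fun_prop) (by fun_prop)
  have h3 : IsClosed {q : ℝ × ℝ | q.2 ≤ k} := isClosed_le (by fun_prop) (by fun_prop)
  exact h1.inter (h2.inter h3)

theorem isClosed_resolvedGraph_carrier (C : SemicircleSeq) (ε : ℝ) :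
    IsClosed (C.resolvedGraph ε).carrier := by
  refine IsClosed.union ?_ (IsClosed.union ?_ ?_)
  · have : IsClosed (⋃ s ∈ (C.arcs : Set UpperSemicircle), (s.arc ∩
        ⋂ p ∈ {p | p ∈ C.resolvedPoints ∧ p ∈ s.arc}, {q : ℝ × ℝ | ε ≤ |q.1 - p.1|})) := by
      refine C.arcs.finite_toSet.isClosed_biUnion fun s _ => s.isClosed_arc.inter ?_
      exact isClosed_biInter fun p _ => isClosed_le (by fun_prop) (by fun_prop)
    refine (congrArg IsClosed (Set.ext fun q => ?_)).mp this
    simp only [Set.mem_iUnion, Set.mem_inter_iff, Set.mem_iInter, Finset.mem_coe, exists_prop]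
    exact exists_congr fun s => and_congr_right fun _ => and_congr_right fun _ =>
      ⟨fun h p hp hps => h p ⟨hp, hps⟩, fun h p hp => h p hp.1 hp.2⟩
  · exact isClosed_iUnion_triples (fun s hs t ht p h => crossAt_triple hs ht h) fun s t p =>
      (isClosed_upperBranch ε s t p).union
        ((isClosed_lowerBranch ε s t p).union (isClosed_verticalEdge _ _ _))
  · exact isClosed_iUnion_triples (fun s _ t _ p h => veeAt_triple h) fun s t p =>
      (isClosed_upperBranch ε s t p).union (isClosed_verticalEdge _ _ _)

theorem isClosed_resolvedGraph_vertices (C : SemicircleSeq) (ε : ℝ) :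
    IsClosed (C.resolvedGraph ε).vertices := by
  refine IsClosed.union ?_ (IsClosed.union ?_ ?_)
  · have : IsClosed (⋃ s ∈ (C.arcs : Set UpperSemicircle), ({s.leftEnd} ∪ {s.rightEnd})) :=
      C.arcs.finite_toSet.isClosed_biUnion fun s _ => isClosed_singleton.union isClosed_singleton
    refine (congrArg IsClosed (Set.ext fun q => ?_)).mp this
    simp only [Set.mem_iUnion, Finset.mem_coe, exists_prop]
    exact Iff.rfl
  · exact isClosed_iUnion_triples (fun s hs t ht p h => crossAt_triple hs ht h) fun s t p =>
      (isClosed_singleton (x := (p.1, p.2 + ε))).union (isClosed_singleton (x := (p.1, p.2 - ε)))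
  · exact isClosed_iUnion_triples (fun s _ t _ p h => veeAt_triple h) fun s t p =>
      isClosed_singleton (x := (p.1, p.2 + ε))

theorem fst_mem_of_mem_vertices {q : ℝ × ℝ} (h0 : 0 < q.2)
    (hq : q ∈ (C.resolvedGraph ε).vertices) : ∃ τ ∈ C.resolvedTriples, τ.2.2.1 = q.1 := by
  rcases hq with ⟨s, hs, h⟩ | ⟨s, hs, t, ht, p, hc, h⟩ | ⟨s, hs, t, ht, p, hv, rfl⟩
  · rcases h with rfl | rfl <;> exact absurd h0 (lt_irrefl _)
  · rcases mem_resolvedTriples_of_crossAt hs ht hc with hm | hm <;> rcases h with rfl | rfl <;>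
      exact ⟨_, hm, rfl⟩
  · exact ⟨_, mem_resolvedTriples_of_veeAt hs ht hv, rfl⟩

theorem snd_le_of_mem (hε : 0 < ε) {q : ℝ × ℝ}
    (hq : q ∈ (C.resolvedGraph ε).carrier ∪ (C.resolvedGraph ε).vertices) :
    q.2 ≤ ∑ s ∈ C.arcs, s.radius + ε := by
  have hr : ∀ s ∈ C.arcs, s.radius ≤ ∑ s ∈ C.arcs, s.radius := fun s hs =>
    Finset.single_le_sum (f := UpperSemicircle.radius) (fun s _ => s.radius_pos.le) hs
  have hr0 : 0 ≤ ∑ s ∈ C.arcs, s.radius := Finset.sum_nonneg fun s _ => s.radius_pos.le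
  have hh : ∀ s ∈ C.arcs, ∀ a, s.height a ≤ ∑ s ∈ C.arcs, s.radius := fun s hs a =>
    (s.height_le_radius a).trans (hr s hs)
  have hp : ∀ s ∈ C.arcs, ∀ p ∈ s.arc, p.2 ≤ ∑ s ∈ C.arcs, s.radius := fun s hs p hp =>
    height_eq_of_mem_arc hp ▸ hh s hs _
  have hu : ∀ s ∈ C.arcs, ∀ t ∈ C.arcs, ∀ p, q ∈ upperBranch ε s t p →
      q.2 ≤ ∑ s ∈ C.arcs, s.radius + ε := by
    rintro s hs t ht p ⟨-, h⟩
    have := max_le (hh s hs q.1) (hh t ht q.1)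
    have := abs_nonneg (q.1 - p.1)
    linarith
  rcases hq with hq | hq
  · rcases hq with ⟨s, hs, h, -⟩ | ⟨s, hs, t, ht, p, hc, h | h | h⟩ | ⟨s, hs, t, ht, p, hv, h | h⟩
    · linarith [hp s hs q h]
    · exact hu s hs t ht p h
    · obtain ⟨h1, h2⟩ := h
      have := (min_le_left (s.height q.1) (t.height q.1)).trans (hh s hs q.1)
      linarith
    · linarith [hp s hs p hc.2.1, h.2.2]
    · exact hu s hs t ht p h
    · linarith [hp s hs p (veeAt_triple hv).2.1, h.2.2]
  · rcases hq with ⟨s, hs, h⟩ | ⟨s, hs, t, ht, p, hc, h⟩ | ⟨s, hs, t, ht, p, hv, rfl⟩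
    · rcases h with rfl | rfl
      · linarith [hp s hs _ s.leftEnd_mem_arc]
      · linarith [hp s hs _ s.rightEnd_mem_arc]
    · have := hp s hs p hc.2.1
      rcases h with rfl | rfl <;> simp only <;> linarith
    · have := hp s hs p (veeAt_triple hv).2.1
      simp only; linarith

/-- The open half-plane above all curves is convex, hence contained in one face. -/
theorem exists_unbounded_face (hε : 0 < ε) {z : ℝ × ℝ}
    (hz : ∑ s ∈ C.arcs, s.radius + ε < z.2) :
    ∃ F ∈ (C.resolvedGraph ε).faces, ¬ Bornology.IsBounded F ∧ z ∈ F := by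
  have hB : 0 < ∑ s ∈ C.arcs, s.radius + ε :=
    add_pos_of_nonneg_of_pos (Finset.sum_nonneg fun s _ => s.radius_pos.le) hε
  set B := ∑ s ∈ C.arcs, s.radius + ε
  have hsub : {q : ℝ × ℝ | B < q.2} ⊆ (C.resolvedGraph ε).faceRegion := fun q hq =>
    ⟨hB.trans hq, fun h => (snd_le_of_mem hε h).not_gt hq⟩
  have hconv : Convex ℝ {q : ℝ × ℝ | B < q.2} :=
    convex_halfSpace_gt (f := Prod.snd) ⟨fun _ _ => rfl, fun _ _ => rfl⟩ B
  have hF := hconv.isPreconnected.subset_connectedComponentIn hz hsub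
  refine ⟨_, ⟨z, hsub hz, rfl⟩, fun hb => ?_, mem_connectedComponentIn (hsub hz)⟩
  obtain ⟨R, hR⟩ := (hb.subset hF).subset_closedBall 0
  have hmem : ((0 : ℝ), max B R + 1) ∈ {q : ℝ × ℝ | B < q.2} :=
    show B < max B R + 1 by linarith [le_max_left B R]
  have := hR hmem
  rw [mem_closedBall_zero_iff, Prod.norm_def, max_le_iff] at this
  have h2 := (le_abs_self _).trans this.2
  simp only at h2
  linarith [le_max_right B R]

/-! ### The upper bound: levels over a generic abscissa -/

/-- The part of the resolved drawing over the abscissa `a` that replaces the semicircle `s` has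
height `y`. -/
def IsLevel (C : SemicircleSeq) (ε : ℝ) (s : UpperSemicircle) (a y : ℝ) : Prop :=
  (y = s.height a ∧ ∀ p ∈ C.resolvedPoints, p ∈ s.arc → ε ≤ |a - p.1|) ∨
    ∃ t ∈ C.arcs, ∃ p, s.CrossAt t p ∧ |a - p.1| ≤ ε ∧
      ((t.height a < s.height a ∧ y = s.height a + (ε - |a - p.1|)) ∨
        (s.height a < t.height a ∧ y = s.height a - (ε - |a - p.1|)))

/-- Crossings of `s` within `ε` of `a` have the same abscissa by `fst_eq`, hence coincide, and `hC`
then fixes the other semicircle. -/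
theorem IsSmall.isLevel_unique (hC : ∀ p : ℝ × ℝ, {s | s ∈ C.arcs ∧ p ∈ s.arc}.encard ≤ 2)
    (hε : C.IsSmall ε) {s : UpperSemicircle} (hs : s ∈ C.arcs) {a y y' : ℝ}
    (h : C.IsLevel ε s a y) (h' : C.IsLevel ε s a y') : y = y' := by
  have key : ∀ {y y' : ℝ}, (y = s.height a ∧ ∀ p ∈ C.resolvedPoints, p ∈ s.arc →
      ε ≤ |a - p.1|) → (∃ t ∈ C.arcs, ∃ p, s.CrossAt t p ∧ |a - p.1| ≤ ε ∧
      ((t.height a < s.height a ∧ y' = s.height a + (ε - |a - p.1|)) ∨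
        (s.height a < t.height a ∧ y' = s.height a - (ε - |a - p.1|)))) → y = y' := by
    rintro y y' ⟨h, h1⟩ ⟨t, ht, p, hc, hp, h2⟩
    -- The distance is exactly `ε` here, so the branch is not shifted.
    have := h1 p ⟨s, hs, t, ht, Or.inl hc⟩ hc.2.1
    rcases h2 with h2 | h2 <;> linarith
  rcases h with h | h <;> rcases h' with h' | h'
  · rw [h.1, h'.1]
  · exact key h h'
  · exact (key h' h).symm
  · obtain ⟨t, ht, p, hc, hp, h⟩ := h
    obtain ⟨t', ht', p', hc', hp', h'⟩ := h'
    have h1 : p.1 = p'.1 := by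
      rcases mem_resolvedTriples_of_crossAt hs ht hc with hm | hm <;>
        rcases mem_resolvedTriples_of_crossAt hs ht' hc' with hm' | hm' <;>
        exact hε.fst_eq _ hm _ hm' a hp hp'
    have h2 : p = p' := by
      refine Prod.ext h1 ?_
      rw [← height_eq_of_mem_arc hc.2.1, ← height_eq_of_mem_arc hc'.2.1, h1]
    subst h2
    have h3 : t' = t := (eq_or_eq_of_mem_arc hC hs ht ht' hc.1 hc.2.1 hc.2.2.1
      hc'.2.2.1).resolve_left hc'.1.symm
    subst h3
    rcases h with h | h <;> rcases h' with h' | h' <;> linarith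

theorem exists_isLevel {x : ℝ × ℝ} (h0 : 0 < x.2)
    (hx : ∀ τ ∈ C.resolvedTriples, x ∉ changedAt ε τ.1 τ.2.1 τ.2.2)
    (hgen : ∀ τ ∈ C.resolvedTriples, τ.2.2.1 ≠ x.1) {y : ℝ} (hy : x.2 < y)
    (hcar : (x.1, y) ∈ (C.resolvedGraph ε).carrier) :
    ∃ s, (s ∈ C.arcs ∧ s.IsAbove x) ∧ C.IsLevel ε s x.1 y := by
  rcases hcar with ⟨s, hs, h, hp⟩ | ⟨s, hs, t, ht, p, hc, h⟩ | ⟨s, hs, t, ht, p, hv, h⟩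
  · exact ⟨s, ⟨hs, y, hy, h⟩, Or.inl ⟨(height_eq_of_mem_arc h).symm, hp⟩⟩
  · have hp1 : p.1 ≠ x.1 ∧ x ∉ changedAt ε s t p := by
      rcases mem_resolvedTriples_of_crossAt hs ht hc with hm | hm
      · exact ⟨hgen _ hm, hx _ hm⟩
      · exact ⟨hgen _ hm, changedAt_comm ε s t p ▸ hx _ hm⟩
    rcases or_assoc.2 h with h | h
    · have hb : |x.1 - p.1| ≤ ε := by rcases h with h | h <;> exact h.1
      -- Being below a branch point but outside the neighbourhood, `x` is below both branches and
      -- hence below both semicircles.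
      have hlow : x.2 < lowerHeight ε p.1 s t x.1 := by
        by_contra! hle
        refine hp1.2 ⟨hb, hle, ?_⟩
        have := min_le_max (a := s.height x.1) (b := t.height x.1)
        rw [upperHeight, bump_of_le hb]
        rcases h with ⟨-, h⟩ | ⟨-, h⟩ <;> simp only at h <;> linarith
      have hmin : x.2 < min (s.height x.1) (t.height x.1) :=
        hlow.trans_le (sub_le_self _ (bump_nonneg _ _ _))
      obtain ⟨hxs, hxt⟩ := lt_min_iff.1 hmin
      have has := (isAbove_iff h0).2 hxs
      have hat := (isAbove_iff h0).2 hxt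
      rcases lt_trichotomy (s.height x.1) (t.height x.1) with hlt | heq | hlt
      · rcases h with ⟨-, h⟩ | ⟨-, h⟩
        · rw [max_eq_right hlt.le] at h
          exact ⟨t, ⟨ht, hat⟩, Or.inr ⟨s, hs, p, hc.symm, hb, Or.inl ⟨hlt, h⟩⟩⟩
        · rw [min_eq_left hlt.le] at h
          exact ⟨s, ⟨hs, has⟩, Or.inr ⟨t, ht, p, hc, hb, Or.inr ⟨hlt, h⟩⟩⟩
      · have h1 : (x.1, s.height x.1) ∈ s.arc := mem_arc_of_height_eq (h0.trans hxs) rfl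
        have h2 : (x.1, s.height x.1) ∈ t.arc := mem_arc_of_height_eq (h0.trans hxs) heq.symm
        exact absurd (fst_eq_of_mem_arc (center_ne hs ht hc.1) hc.2.1 hc.2.2.1 h1 h2) hp1.1
      · rcases h with ⟨-, h⟩ | ⟨-, h⟩
        · rw [max_eq_left hlt.le] at h
          exact ⟨s, ⟨hs, has⟩, Or.inr ⟨t, ht, p, hc, hb, Or.inl ⟨hlt, h⟩⟩⟩
        · rw [min_eq_right hlt.le] at h
          exact ⟨t, ⟨ht, hat⟩, Or.inr ⟨s, hs, p, hc.symm, hb, Or.inr ⟨hlt, h⟩⟩⟩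
    · exact absurd h.1.symm hp1.1
  · have hm := mem_resolvedTriples_of_veeAt hs ht hv
    rcases h with ⟨hb, h⟩ | h
    -- Everything above the line and below the new branch at a V is changed, so `x` cannot lie
    -- there.
    · refine absurd ⟨hb, ?_, ?_⟩ (hx _ hm)
      · simp only [lowerHeight]
        rw [hv.min_height]
        linarith [bump_nonneg ε p.1 x.1]
      · simp only [upperHeight]
        rw [bump_of_le hb]
        simp only at h
        linarith
    · exact absurd h.1.symm (hgen _ hm)

/-- The path from `x` that moves horizontally to the abscissa `a` and then up by `B`. -/
noncomputable def cornerPath (x : ℝ × ℝ) (a B : ℝ) : Path x (a, x.2 + B) where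
  toFun t := (x.1 + (a - x.1) * min 1 (2 * (t : ℝ)), x.2 + B * max 0 (2 * (t : ℝ) - 1))
  continuous_toFun := by fun_prop
  source' := by ext <;> simp
  target' := by ext <;> norm_num

theorem cornerPath_of_le {x : ℝ × ℝ} {a B : ℝ} {t : unitInterval} (ht : 2 * (t : ℝ) ≤ 1) :
    cornerPath x a B t = (x.1 + (a - x.1) * (2 * (t : ℝ)), x.2) := by
  change (x.1 + (a - x.1) * min 1 (2 * (t : ℝ)), x.2 + B * max 0 (2 * (t : ℝ) - 1)) = _
  rw [min_eq_right ht, max_eq_left (by linarith), mul_zero, add_zero]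

theorem cornerPath_of_lt {x : ℝ × ℝ} {a B : ℝ} {t : unitInterval} (ht : 1 < 2 * (t : ℝ)) :
    cornerPath x a B t = (a, x.2 + B * (2 * (t : ℝ) - 1)) := by
  change (x.1 + (a - x.1) * min 1 (2 * (t : ℝ)), x.2 + B * max 0 (2 * (t : ℝ) - 1)) = _
  rw [min_eq_left ht.le, max_eq_right (by linarith)]
  ext <;> simp

/-- The horizontal half of the path stays in a ball free of the drawing; the crossings on the
vertical half inject into the semicircles above its starting point. -/
theorem IsSmall.exists_path_crossingNumber_le
    (hC : ∀ p : ℝ × ℝ, {s | s ∈ C.arcs ∧ p ∈ s.arc}.encard ≤ 2) (hε : C.IsSmall ε)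
    {x : ℝ × ℝ} (hxg : x ∈ C.graph.faceRegion) (hxr : x ∈ (C.resolvedGraph ε).faceRegion)
    (hx : x ∉ C.changedRegion ε) :
    ∃ F ∈ (C.resolvedGraph ε).faces, ¬ Bornology.IsBounded F ∧ ∃ z ∈ F, ∃ γ : Path x z,
      (C.resolvedGraph ε).IsAdmissible γ ∧
        (C.resolvedGraph ε).crossingNumber γ ≤ C.circleDepth x := by
  have h0 := hxr.1
  have hface : ∀ᶠ q in 𝓝 x, q ∉ (C.resolvedGraph ε).carrier ∪ (C.resolvedGraph ε).vertices :=
    ((C.isClosed_resolvedGraph_carrier ε).union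
      (C.isClosed_resolvedGraph_vertices ε)).isOpen_compl.mem_nhds hxr.2
  have hchanged : ∀ᶠ q in 𝓝 x, ∀ τ ∈ C.resolvedTriples, q ∉ changedAt ε τ.1 τ.2.1 τ.2.2 :=
    (eventually_all_finite C.finite_resolvedTriples).2 fun τ hτ =>
      (isClosed_changedAt ε τ.1 τ.2.1 τ.2.2).isOpen_compl.mem_nhds
        (notMem_changedAt_of_notMem_changedRegion h0 hx τ hτ)
  have hdepth : ∀ᶠ q in 𝓝 x, ∑ s ∈ C.arcs, belowGraph s.height q =
      ∑ s ∈ C.arcs, belowGraph s.height x :=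
    eventually_sum_belowGraph_eq _ (fun s _ => s.continuous_height) fun s hs h =>
      hxg.2 (Or.inl ⟨s, hs, mem_arc_of_height_eq h0 h⟩)
  obtain ⟨δ, hδ, hball⟩ := Metric.eventually_nhds_iff.1 (hface.and (hchanged.and hdepth))
  -- An interval is infinite, so it contains an abscissa different from those of the finitely many
  -- resolved points.
  obtain ⟨a, ⟨ha1, ha2⟩, hgen⟩ := ((Set.Ioo_infinite (show x.1 < x.1 + δ by linarith)).sdiff
    (C.finite_resolvedTriples.image fun τ => τ.2.2.1)).nonempty
  have hnear : ∀ b, 0 ≤ b → b ≤ 1 → dist (x.1 + (a - x.1) * b, x.2) x < δ := by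
    intro b hb0 hb1
    rw [Prod.dist_eq, Real.dist_eq]
    simp only [add_sub_cancel_left, dist_self]
    rw [max_eq_left (abs_nonneg _), abs_of_nonneg (mul_nonneg (by linarith) hb0)]
    nlinarith
  have hax := hball (hnear 1 zero_le_one le_rfl)
  rw [mul_one, add_sub_cancel] at hax
  have hgen' : ∀ τ ∈ C.resolvedTriples, τ.2.2.1 ≠ a := fun τ hτ h => hgen ⟨τ, hτ, h⟩
  have hB : 0 < ∑ s ∈ C.arcs, s.radius + ε :=
    add_pos_of_nonneg_of_pos (Finset.sum_nonneg fun s _ => s.radius_pos.le) hε.pos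
  set B := ∑ s ∈ C.arcs, s.radius + ε
  obtain ⟨F, hF, hFb, hzF⟩ := exists_unbounded_face (C := C) hε.pos
    (z := (a, x.2 + B)) (show B < x.2 + B by linarith)
  refine ⟨F, hF, hFb, _, hzF, cornerPath x a B, fun t => ?_, ?_⟩
  · rcases le_or_gt (2 * (t : ℝ)) 1 with ht | ht
    · rw [cornerPath_of_le ht]
      exact ⟨h0, fun h => (hball (hnear _ (by linarith [t.2.1]) ht)).1 (Or.inr h)⟩
    · rw [cornerPath_of_lt ht]
      have hpos : 0 < x.2 + B * (2 * (t : ℝ) - 1) :=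
        add_pos h0 (mul_pos hB (by linarith))
      refine ⟨hpos, fun h => ?_⟩
      obtain ⟨τ, hτ, h⟩ := fst_mem_of_mem_vertices (by exact hpos) h
      exact hgen' τ hτ h
  · rw [crossingNumber_eq]
    have hlevel : ∀ t ∈ {t | cornerPath x a B t ∈
        (C.resolvedGraph ε).carrier \ (C.resolvedGraph ε).vertices},
        ∃ s, (s ∈ C.arcs ∧ s.IsAbove (a, x.2)) ∧
          C.IsLevel ε s a (x.2 + B * (2 * (t : ℝ) - 1)) := by
      rintro t ⟨ht, -⟩
      rcases le_or_gt (2 * (t : ℝ)) 1 with h | h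
      · rw [cornerPath_of_le h] at ht
        exact absurd (Or.inl ht) (hball (hnear _ (by linarith [t.2.1]) h)).1
      · rw [cornerPath_of_lt h] at ht
        exact exists_isLevel (x := (a, x.2)) h0 hax.2.1 hgen'
          (lt_add_of_pos_right _ (mul_pos hB (by linarith))) ht
    have : Nonempty UpperSemicircle := ⟨⟨0, 1, one_pos⟩⟩
    choose! σ hσ hσl using hlevel
    have hd : C.circleDepth x = C.circleDepth (a, x.2) := by
      have h1 := circleDepth_eq_sum (C := C) h0
      have h2 := circleDepth_eq_sum (C := C) (q := (a, x.2)) h0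
      rw [hax.2.2] at h2
      exact_mod_cast h1.trans h2.symm
    rw [hd, circleDepth, Set.Finite.cast_ncard_eq
      (C.arcs.finite_toSet.subset fun s hs => hs.1)]
    -- Equal semicircles give equal levels, and the height on the vertical half determines the
    -- parameter because `B` is nonzero.
    refine Set.encard_le_encard_of_injOn (f := σ) hσ fun t ht t' ht' h => ?_
    have h1 := hσl t ht
    rw [h] at h1
    have := hε.isLevel_unique hC (hσ t' ht').1 h1 (hσl t' ht')
    have := mul_left_cancel₀ hB.ne' (add_left_cancel this)
    exact Subtype.ext (by linarith)

end SemicircleSeq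

theorem mainTheorem6 (C : SemicircleSeq)
    (hC : ∀ p : ℝ × ℝ, {s | s ∈ C.arcs ∧ p ∈ s.arc}.encard ≤ 2) :
    ∀ᶠ ε in 𝓝[>] (0 : ℝ), ∀ x : ℝ × ℝ,
      x ∈ C.graph.faceRegion → x ∈ (C.resolvedGraph ε).faceRegion → x ∉ C.changedRegion ε →
        (C.circleDepth x : ℕ∞) = (C.resolvedGraph ε).pathDepth x := by
  filter_upwards [C.eventually_isSmall hC] with ε hε x hxg hxr hx
  apply le_antisymm
  · refine le_sInf ?_
    rintro _ ⟨F, hF, hb, z, hz, γ, hγ, rfl⟩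
    exact hε.circleDepth_le_crossingNumber hC hxr.1 hx hF hb hz γ hγ
  · obtain ⟨F, hF, hb, z, hz, γ, hγ, hle⟩ := hε.exists_path_crossingNumber_le hC hxg hxr hx
    refine le_trans (sInf_le ?_) hle
    exact ⟨F, hF, hb, z, hz, γ, hγ, rfl⟩
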